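/- Let $\ell\ge 1$ be an integer, let $0<p<q=1-p$, and let $P_\ell=U^\ell V^\ell$ be the transition matrix on $\{0,1,2,\dots\}$ of the queue at a traffic light observed once per cycle, where $U_{n,n}=q$, $U_{n,n+1}=p$ for $n\ge 0$ (one unit of red time), $V_{0,0}=1$, $V_{n,n}=p$, $V_{n,n-1}=q$ for $n\ge 1$ (one unit of green time), and all other entries are $0$. Grouping the states into levels $\{\ell n,\dots,\ell n+\ell-1\}$ of size $\ell$ makes $P_\ell$ a quasi-birth-and-death matrix; let $A_{-1},A_0,A_1$ be its $\ell\times\ell$ blocks of transitions from a level $n\ge1$ to the levels $n-1,n,n+1$; their entries are $(A_k)_{ij}=p_{k\ell+j-i}$ with $p_m=\binom{2\ell}{\ell+m}p^{\ell+m}q^{\ell-m}$ for $|m|\le \ell$ and $p_m=0$ otherwise. There is exactly one real matrix $R$ with non-negative entries and with all eigenvalues in the open unit disk such that $$R^2A_{-1}+R(A_0-I)+A_1=0 ;$$ it is called the rate matrix of $P_\ell$. Let $\omega_\ell=e^{2\pi \mathrm i/\ell}$ and, for $1\le j\le \ell$, let $\mu_j$ be the root of larger modulus of the quadratic polynomial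 $(pz+q)^2-\omega_\ell^{\,j-1}z$. Put $v_j=(1,\mu_j^{-1},\dots,\mu_j^{-(\ell-1)})$, let $V_R$ be the $\ell\times \ell$ Vandermonde matrix with rows $v_1,\dots,v_\ell$, and let $D_R=\mathrm{diag}(\mu_1^{-1},\dots,\mu_\ell^{-1})$. Then $V_R$ is invertible and $$R=V_R^{-1}D_R^{\ell}V_R .$$ Each $v_j$ is a left eigenvector of $R$, for the eigenvalue $\mu_j^{-\ell}$. Every eigenvalue of $R$ having a left eigenvector equals $\mu_j^{-\ell}$ for some $j$, and every left eigenvector for an eigenvalue $\lambda$ is a linear combination of the $v_j$ with $\mu_j^{-\ell}=\lambda$. In particular, if $\mu_j^{-\ell}=\lambda$ for only one index $j$, then every left eigenvector for $\lambda$ is a non-zero scalar multiple of $v_j=(1,\mu_j^{-1},\dots,\mu_j^{-(\ell-1)})$. -/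

import Mathlib

namespace TrafficLight

noncomputable section

/-! A finitely supported function `x : ℕ →₀ ℝ` is read as a row vector indexed by the queue length,
and a row-finite infinite matrix `M` as the linear map `x ↦ x M`; the image of `single m 1` is the
row of index `m`. -/

/-- Transition matrix `U` of one unit of time with a red light: from `m`, stay with probability
`q = 1 - p`, move to `m + 1` with probability `p`. -/
def redStep (p : ℝ) : Module.End ℝ (ℕ →₀ ℝ) :=
  Finsupp.linearCombination ℝ
    (fun m : ℕ => Finsupp.single m (1 - p) + Finsupp.single (m + 1) p)

/-- Row `m` of the transition matrix `V` of one unit of time with a green light: an empty line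
stays empty; a line of length `m + 1` stays with probability `p` and loses one car with
probability `q = 1 - p`. -/
def greenRow (p : ℝ) : ℕ → (ℕ →₀ ℝ)
  | 0 => Finsupp.single 0 1
  | m + 1 => Finsupp.single (m + 1) p + Finsupp.single m (1 - p)

/-- Transition matrix `V` of one unit of time with a green light. -/
def greenStep (p : ℝ) : Module.End ℝ (ℕ →₀ ℝ) :=
  Finsupp.linearCombination ℝ (greenRow p)

/-- The entry `(m, n)` of the transition matrix `P_ℓ = U ^ ℓ V ^ ℓ` over a full cycle of `ℓ` red
units of time followed by `ℓ` green ones (row vectors are multiplied by `U ^ ℓ` first). -/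
def cycleMatrix (p : ℝ) (ℓ : ℕ) : Matrix ℕ ℕ ℝ :=
  fun m n => ((greenStep p ^ ℓ) ((redStep p ^ ℓ) (Finsupp.single m 1))) n

/-- The `ℓ × ℓ` block of `P_ℓ` of transitions from level `a` to level `b`, where level `a` is
`{ℓ a, …, ℓ a + ℓ - 1}`. -/
def levelBlock (p : ℝ) (ℓ a b : ℕ) : Matrix (Fin ℓ) (Fin ℓ) ℝ :=
  fun i j => cycleMatrix p ℓ (ℓ * a + i) (ℓ * b + j)

/-- The QBD block `A₋₁` (one level down); the block row of level `1` is already homogeneous. -/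
def blockDown (p : ℝ) (ℓ : ℕ) : Matrix (Fin ℓ) (Fin ℓ) ℝ := levelBlock p ℓ 1 0

/-- The QBD block `A₀` (same level). -/
def blockSame (p : ℝ) (ℓ : ℕ) : Matrix (Fin ℓ) (Fin ℓ) ℝ := levelBlock p ℓ 1 1

/-- The QBD block `A₁` (one level up). -/
def blockUp (p : ℝ) (ℓ : ℕ) : Matrix (Fin ℓ) (Fin ℓ) ℝ := levelBlock p ℓ 1 2

/-- A real matrix seen as a complex matrix. -/
def toComplex {ℓ : ℕ} (R : Matrix (Fin ℓ) (Fin ℓ) ℝ) : Matrix (Fin ℓ) (Fin ℓ) ℂ :=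
  R.map Complex.ofReal

/-- The defining property of the rate matrix of the QBD `P_ℓ`: it is non-negative, all its
eigenvalues lie in the open unit disk, and `R² A₋₁ + R (A₀ - I) + A₁ = 0`. -/
structure IsRateMatrix (p : ℝ) (ℓ : ℕ) (R : Matrix (Fin ℓ) (Fin ℓ) ℝ) : Prop where
  nonneg : ∀ i j, 0 ≤ R i j
  eigenvalue_lt_one : ∀ z ∈ spectrum ℂ (toComplex R), ‖z‖ < 1
  equation : R ^ 2 * blockDown p ℓ + R * (blockSame p ℓ - 1) + blockUp p ℓ = 0

/-- The primitive root of unity `ω_ℓ = cos (2π/ℓ) + i sin (2π/ℓ)`. -/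
def omega (ℓ : ℕ) : ℂ := Complex.exp (2 * Real.pi * Complex.I / ℓ)

open Polynomial in
/-- The quadratic polynomial `(p z + q)² - ω_ℓ ^ j z`, with `q = 1 - p`. -/
def quad (p : ℝ) (ℓ j : ℕ) : ℂ[X] :=
  (C (p : ℂ) * X + C (1 - p : ℂ)) ^ 2 - C (omega ℓ ^ j) * X

theorem exists_dominant_root (p : ℝ) (ℓ j : ℕ) :
    ∃ z : ℂ, (quad p ℓ j).IsRoot z ∧ ∀ w : ℂ, (quad p ℓ j).IsRoot w → ‖w‖ ≤ ‖z‖ := by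
  have hω : omega ℓ ^ j ≠ 0 := pow_ne_zero _ (Complex.exp_ne_zero _)
  have hdeg : (quad p ℓ j).degree ≠ 0 := by
    intro h
    have hc := Polynomial.eq_C_of_degree_eq_zero h
    have e : ∀ x : ℂ, ((p : ℂ) * x + (1 - p)) ^ 2 - omega ℓ ^ j * x = (quad p ℓ j).coeff 0 := by
      intro x
      have := congrArg (Polynomial.eval x) hc
      simpa [quad] using this
    have h0 := e 0
    have h1 := e 1
    have h2 := e (-1)
    have hp : (p : ℂ) ^ 2 = 0 := by linear_combination (h1 + h2 - 2 * h0) / 2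
    have hp' : (p : ℂ) = 0 := by simpa using hp
    rw [hp'] at h0 h1
    exact hω (by linear_combination h0 - h1)
  have hne : quad p ℓ j ≠ 0 := by
    intro h
    have e : ∀ x : ℂ, ((p : ℂ) * x + (1 - p)) ^ 2 - omega ℓ ^ j * x = 0 := by
      intro x
      have := congrArg (Polynomial.eval x) h
      simpa [quad] using this
    have h0 := e 0
    have h1 := e 1
    have h2 := e (-1)
    have hp : (p : ℂ) ^ 2 = 0 := by linear_combination (h1 + h2 - 2 * h0) / 2
    have hp' : (p : ℂ) = 0 := by simpa using hp
    rw [hp'] at h0 h1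
    exact hω (by linear_combination h0 - h1)
  obtain ⟨r, hr⟩ := IsAlgClosed.exists_root _ hdeg
  obtain ⟨z, hz, hmax⟩ := (quad p ℓ j).roots.toFinset.exists_max_image (fun w => ‖w‖)
    ⟨r, by simpa [hne] using hr⟩
  exact ⟨z, by simpa [hne] using hz, fun w hw => hmax w (by simpa [hne] using hw)⟩

/-- The root of larger modulus of the quadratic polynomial `(p z + q)² - ω_ℓ ^ j z`. The index `j`
runs from `0` to `ℓ - 1`. -/
def mu (p : ℝ) (ℓ j : ℕ) : ℂ := Classical.choose (exists_dominant_root p ℓ j)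

/-- The Vandermonde matrix with rows `(1, μ_j⁻¹, …, μ_j⁻⁽ℓ⁻¹⁾)`. -/
def VR (p : ℝ) (ℓ : ℕ) : Matrix (Fin ℓ) (Fin ℓ) ℂ :=
  Matrix.vandermonde (fun j : Fin ℓ => (mu p ℓ j)⁻¹)

/-- The diagonal matrix with diagonal entries `μ_j⁻¹`. -/
def DR (p : ℝ) (ℓ : ℕ) : Matrix (Fin ℓ) (Fin ℓ) ℂ :=
  Matrix.diagonal (fun j : Fin ℓ => (mu p ℓ j)⁻¹)

/-- `x` is a left eigenvector of `M` for the eigenvalue `c`. -/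
def IsLeftEigenvector {ℓ : ℕ} (M : Matrix (Fin ℓ) (Fin ℓ) ℂ) (c : ℂ) (x : Fin ℓ → ℂ) : Prop :=
  x ≠ 0 ∧ Matrix.vecMul x M = c • x

end

end TrafficLight

/-! Write `q = 1 - p`. For a row `x`, place the blocks `x`, `x R`, `x R²`, … end to end. The rate
equation says exactly that every such scalar sequence satisfies the linear recurrence with
characteristic polynomial `(qX + p)^(2ℓ) - X^ℓ` (`aeval_shift_revPoly_blockSeq`). This splits over
the `ℓ`-th roots of unity into quadratics with roots `μ_j⁻¹` and `p² μ_j / q²`, the latter of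
modulus at least 1 (`sq_le_norm_mu`). By Cayley–Hamilton the sequence is also killed by `χ_R(X^ℓ)`,
whose roots lie in the open disk, so only `∏ (X - μ_j⁻¹)`, of degree `ℓ`, is left. Starting from `x
= v_j` the sequence must then be geometric, and its second block gives `v_j R = μ_j^(-ℓ) v_j`. The
`μ_j` are distinct, so the `v_j` form a basis; this determines `R` and all its left eigenvectors.
Existence is separate: monotone iteration of the rate equation from 0, kept bounded by a geometric
subinvariant row. -/

namespace TrafficLight

/-! ### Rows of the cycle matrix as coefficients of polynomials. -/

section Rows

open Polynomial

/-- The generating polynomial of a finitely supported row vector. -/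
noncomputable def genPoly : (ℕ →₀ ℝ) →ₗ[ℝ] ℝ[X] :=
  Finsupp.linearCombination ℝ (fun n : ℕ => (X : ℝ[X]) ^ n)

lemma genPoly_single (m : ℕ) (a : ℝ) : genPoly (Finsupp.single m a) = C a * X ^ m := by
  simp [genPoly, Finsupp.linearCombination_single, smul_eq_C_mul]

lemma coeff_genPoly (x : ℕ →₀ ℝ) (n : ℕ) : (genPoly x).coeff n = x n := by
  induction x using Finsupp.induction_linear with
  | zero => simp
  | add f g hf hg => simp [hf, hg]
  | single m a =>
    rw [genPoly_single, coeff_C_mul_X_pow, Finsupp.single_apply]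
    simp only [eq_comm]

lemma genPoly_redStep (p : ℝ) (x : ℕ →₀ ℝ) :
    genPoly (redStep p x) = (C p * X + C (1 - p)) * genPoly x := by
  induction x using Finsupp.induction_linear with
  | zero => simp
  | add f g hf hg => rw [map_add, map_add, hf, hg, map_add, mul_add]
  | single m a =>
    simp only [redStep, Finsupp.linearCombination_single, map_smul, map_add, genPoly_single,
      smul_eq_C_mul]
    ring

/-- The factor `X` avoids Laurent polynomials; the last term corrects for the empty queue, which
cannot lose a car. -/
lemma X_mul_genPoly_greenStep (p : ℝ) (x : ℕ →₀ ℝ) :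
    X * genPoly (greenStep p x) =
      (C p * X + C (1 - p)) * genPoly x + C (x 0) * (X - (C p * X + C (1 - p))) := by
  induction x using Finsupp.induction_linear with
  | zero => simp
  | add f g hf hg =>
    rw [map_add, map_add, mul_add, hf, hg, map_add, Finsupp.add_apply, map_add]
    ring
  | single m a =>
    cases m with
    | zero =>
      simp only [greenStep, Finsupp.linearCombination_single, greenRow, map_smul, genPoly_single,
        smul_eq_C_mul, Finsupp.single_eq_same, map_one]
      ring
    | succ m =>
      simp only [greenStep, Finsupp.linearCombination_single, greenRow, map_smul, genPoly_single,
        smul_eq_C_mul, map_add]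
      rw [Finsupp.single_eq_of_ne (by omega), map_zero]
      ring

lemma genPoly_redStep_pow (p : ℝ) (k : ℕ) (x : ℕ →₀ ℝ) :
    genPoly ((redStep p ^ k) x) = (C p * X + C (1 - p)) ^ k * genPoly x := by
  induction k with
  | zero => simp
  | succ k ih => rw [pow_succ', Module.End.mul_apply, genPoly_redStep, ih]; ring

/-- With at least `k` cars waiting, the queue is non-empty before each of the `k` green steps, so
the boundary correction never enters. -/
lemma genPoly_greenStep_pow (p : ℝ) (k : ℕ) (x : ℕ →₀ ℝ) (f : ℝ[X])
    (h : genPoly x = X ^ k * f) :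
    genPoly ((greenStep p ^ k) x) = (C p * X + C (1 - p)) ^ k * f := by
  induction k generalizing x f with
  | zero => simpa using h
  | succ k ih =>
    have h0 : x 0 = 0 := by rw [← coeff_genPoly, h, pow_succ', mul_assoc]; simp
    have h1 := X_mul_genPoly_greenStep p x
    rw [h0, h, map_zero, zero_mul, add_zero] at h1
    have h2 : genPoly (greenStep p x) = X ^ k * ((C p * X + C (1 - p)) * f) :=
      mul_left_cancel₀ (X_ne_zero (R := ℝ)) (by rw [h1]; ring)
    rw [pow_succ, Module.End.mul_apply, ih _ _ h2]
    ring

lemma cycleMatrix_add (p : ℝ) (ℓ i n : ℕ) :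
    cycleMatrix p ℓ (ℓ + i) n = (X ^ i * (C p * X + C (1 - p)) ^ (2 * ℓ)).coeff n := by
  rw [cycleMatrix, ← coeff_genPoly,
    genPoly_greenStep_pow p ℓ _ (X ^ i * (C p * X + C (1 - p)) ^ ℓ)]
  · congr 1; ring
  · rw [genPoly_redStep_pow, genPoly_single, map_one]; ring

lemma coeff_linear_pow {K : Type*} [CommRing K] (a b : K) (n k : ℕ) :
    ((C a * X + C b) ^ n).coeff k = a ^ k * b ^ (n - k) * (n.choose k : K) := by
  have h : (C a * X + C b) ^ n = ((X + C b) ^ n).comp (C a * X) := by simp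
  rw [h, comp_C_mul_X_coeff, coeff_X_add_C_pow]
  ring

/-- The polynomial whose coefficients, read backwards, are the increments of the free walk. -/
noncomputable def revPoly (p : ℝ) (ℓ : ℕ) : ℝ[X] := (C (1 - p) * X + C p) ^ (2 * ℓ)

lemma coeff_X_pow_mul_eq_revPoly (p : ℝ) (ℓ j r : ℕ) (hr : r ≤ 2 * ℓ) :
    (X ^ (j + r) * (C p * X + C (1 - p)) ^ (2 * ℓ)).coeff (2 * ℓ + j) = (revPoly p ℓ).coeff r := by
  have e : 2 * ℓ + j = (2 * ℓ - r) + (j + r) := by omega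
  rw [e, coeff_X_pow_mul, revPoly, coeff_linear_pow, coeff_linear_pow, Nat.choose_symm hr,
    Nat.sub_sub_self hr]
  ring

lemma coeff_X_pow_mul_eq_zero (p : ℝ) (ℓ j s : ℕ) (hs : s < j ∨ 2 * ℓ + j < s) :
    (X ^ s * (C p * X + C (1 - p)) ^ (2 * ℓ)).coeff (2 * ℓ + j) = 0 := by
  rw [coeff_X_pow_mul', coeff_linear_pow]
  split_ifs with h
  · rw [Nat.choose_eq_zero_of_lt (by omega)]; simp
  · rfl

/-- Only the increment matters, so the target is moved to level 2 and the source to `s = (2 - b)ℓ +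
i`. All three blocks then share the coefficient index `2ℓ + j`. -/
lemma levelBlock_one (p : ℝ) (ℓ b : ℕ) (i j : Fin ℓ) (s : ℕ) (hs : s + b * ℓ = 2 * ℓ + i) :
    levelBlock p ℓ 1 b i j =
      (X ^ s * (C p * X + C (1 - p)) ^ (2 * ℓ)).coeff (2 * ℓ + j) := by
  rw [levelBlock, mul_one, cycleMatrix_add, coeff_X_pow_mul', coeff_X_pow_mul']
  have hb : b * ℓ = ℓ * b := mul_comm _ _
  by_cases h : (i : ℕ) ≤ ℓ * b + j
  · rw [if_pos h, if_pos (by omega)]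
    congr 1
    omega
  · rw [if_neg h, if_neg (by omega)]

/-- Stacked, the `j`-th columns of the three blocks form one column of length `3ℓ`, supported on the
window from `j` to `j + 2ℓ`. This turns the matrix equation into a scalar recurrence. -/
lemma block_sum {M : Type*} [AddCommGroup M] [Module ℝ M] (p : ℝ) (ℓ : ℕ) (u : ℕ → M)
    (j : Fin ℓ) :
    ∑ i : Fin ℓ, blockDown p ℓ i j • u (2 * ℓ + i) + ∑ i : Fin ℓ, blockSame p ℓ i j • u (ℓ + i)
      + ∑ i : Fin ℓ, blockUp p ℓ i j • u i
      = ∑ r ∈ Finset.range (2 * ℓ + 1), (revPoly p ℓ).coeff r • u (j + r) := by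
  set g : ℕ → M := fun s =>
    (X ^ s * (C p * X + C (1 - p)) ^ (2 * ℓ)).coeff (2 * ℓ + j) • u s with hg
  have h0 : ∑ i : Fin ℓ, blockDown p ℓ i j • u (2 * ℓ + i)
      = ∑ i ∈ Finset.range ℓ, g (ℓ + ℓ + i) := by
    rw [← Fin.sum_univ_eq_sum_range (fun i => g (ℓ + ℓ + i))]
    refine Finset.sum_congr rfl fun i _ => ?_
    rw [hg, blockDown, levelBlock_one p ℓ 0 i j (ℓ + ℓ + i) (by omega), two_mul]
  have h1 : ∑ i : Fin ℓ, blockSame p ℓ i j • u (ℓ + i) = ∑ i ∈ Finset.range ℓ, g (ℓ + i) := by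
    rw [← Fin.sum_univ_eq_sum_range (fun i => g (ℓ + i))]
    refine Finset.sum_congr rfl fun i _ => ?_
    rw [hg, blockSame, levelBlock_one p ℓ 1 i j (ℓ + i) (by omega)]
  have h2 : ∑ i : Fin ℓ, blockUp p ℓ i j • u i = ∑ i ∈ Finset.range ℓ, g i := by
    rw [← Fin.sum_univ_eq_sum_range g]
    refine Finset.sum_congr rfl fun i _ => ?_
    rw [hg, blockUp, levelBlock_one p ℓ 2 i j i (by omega)]
  have h3 : ∑ r ∈ Finset.range (2 * ℓ + 1), (revPoly p ℓ).coeff r • u (j + r)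
      = ∑ r ∈ Finset.range (2 * ℓ + 1), g (j + r) := by
    refine Finset.sum_congr rfl fun r hr => ?_
    rw [hg]
    simp only
    rw [coeff_X_pow_mul_eq_revPoly p ℓ j r (by simp at hr; omega)]
  have hj := j.isLt
  obtain ⟨d, hd⟩ : ∃ d, ℓ + ℓ + ℓ = (j + (2 * ℓ + 1)) + d :=
    ⟨ℓ + ℓ + ℓ - (j + (2 * ℓ + 1)), by omega⟩
  have h4 : ∑ s ∈ Finset.range (ℓ + ℓ + ℓ), g s
      = ∑ r ∈ Finset.range (2 * ℓ + 1), g (j + r) := by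
    rw [hd, Finset.sum_range_add, Finset.sum_range_add, Finset.sum_eq_zero, zero_add,
      Finset.sum_eq_zero (s := Finset.range d), add_zero]
    · intro s hs
      simp only [hg]
      rw [coeff_X_pow_mul_eq_zero p ℓ j _ (by omega), zero_smul]
    · intro s hs
      simp only [hg]
      rw [coeff_X_pow_mul_eq_zero p ℓ j _ (by simp at hs; omega), zero_smul]
  rw [h0, h1, h2, h3, ← h4, Finset.sum_range_add, Finset.sum_range_add]
  abel

end Rows

/-! ### The roots `μ_j` and the factorization of the characteristic polynomial. -/

section Roots

open Polynomial

lemma isPrimitiveRoot_omega (ℓ : ℕ) (hℓ : 1 ≤ ℓ) : IsPrimitiveRoot (omega ℓ) ℓ :=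
  Complex.isPrimitiveRoot_exp ℓ (by omega)

lemma isRoot_quad_iff (p : ℝ) (ℓ j : ℕ) (z : ℂ) :
    (quad p ℓ j).IsRoot z ↔ ((p : ℂ) * z + (1 - p)) ^ 2 = omega ℓ ^ j * z := by
  simp [quad, sub_eq_zero]

lemma mu_equation (p : ℝ) (ℓ j : ℕ) :
    ((p : ℂ) * mu p ℓ j + (1 - p)) ^ 2 = omega ℓ ^ j * mu p ℓ j :=
  (isRoot_quad_iff p ℓ j _).1 (Classical.choose_spec (exists_dominant_root p ℓ j)).1

lemma norm_le_norm_mu (p : ℝ) (ℓ j : ℕ) (w : ℂ)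
    (hw : ((p : ℂ) * w + (1 - p)) ^ 2 = omega ℓ ^ j * w) : ‖w‖ ≤ ‖mu p ℓ j‖ :=
  (Classical.choose_spec (exists_dominant_root p ℓ j)).2 w ((isRoot_quad_iff p ℓ j _).2 hw)

lemma one_sub_ofReal_ne_zero {p : ℝ} (hq : 0 < 1 - p) : (1 - p : ℂ) ≠ 0 := by
  exact_mod_cast hq.ne'

lemma mu_ne_zero {p : ℝ} (hq : 0 < 1 - p) (ℓ j : ℕ) : mu p ℓ j ≠ 0 := by
  intro h
  have := mu_equation p ℓ j
  rw [h] at this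
  simp only [mul_zero, zero_add] at this
  exact one_sub_ofReal_ne_zero hq (pow_eq_zero_iff two_ne_zero |>.1 this)

/-- With `r = ‖pμ + q‖`, so `r² = ‖μ‖`, the triangle inequality reads `(r - 1)(pr - q) ≥ 0`;
dominance of `μ` forces `r > 1`, hence `pr ≥ q`. Equality occurs for `j = 0`, where `μ = q²/p²`. -/
lemma sq_le_norm_mu {p : ℝ} (hp : 0 < p) (hpq : p < 1 - p) (ℓ j : ℕ) (hℓ : 1 ≤ ℓ) :
    (1 - p) ^ 2 ≤ p ^ 2 * ‖mu p ℓ j‖ := by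
  have hq : 0 < 1 - p := hp.trans hpq
  have hμ := mu_ne_zero hq ℓ j
  have heq := mu_equation p ℓ j
  have hpc : (p : ℂ) ≠ 0 := by exact_mod_cast hp.ne'
  have hω : ‖omega ℓ ^ j‖ = 1 := by
    rw [norm_pow, (isPrimitiveRoot_omega ℓ hℓ).norm'_eq_one (by omega), one_pow]
  set μ := mu p ℓ j
  have hn : 0 < ‖μ‖ := norm_pos_iff.2 hμ
  -- By Vieta this quotient is the other root.
  have h1 : ‖(1 - p : ℂ) ^ 2 / (p ^ 2 * μ)‖ ≤ ‖μ‖ := by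
    refine norm_le_norm_mu p ℓ j _ ?_
    have : (p : ℂ) * ((1 - p : ℂ) ^ 2 / (p ^ 2 * μ)) + (1 - p)
        = (1 - p) / (p * μ) * (p * μ + (1 - p)) := by
      field_simp
      ring
    rw [this, mul_pow, heq]
    field_simp
  have hnq : ‖(1 - p : ℂ)‖ = 1 - p := by
    rw [← Complex.ofReal_one, ← Complex.ofReal_sub, Complex.norm_real, Real.norm_of_nonneg hq.le]
  have hnp : ‖(p : ℂ)‖ = p := by rw [Complex.norm_real, Real.norm_of_nonneg hp.le]
  rw [norm_div, norm_mul, norm_pow, norm_pow, hnq, hnp, div_le_iff₀ (by positivity)] at h1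
  have h2 : 1 - p ≤ p * ‖μ‖ := by
    refine le_of_sq_le_sq ?_ (by positivity)
    linarith [h1]
  set r := ‖(p : ℂ) * μ + (1 - p)‖ with hr
  have hr2 : r ^ 2 = ‖μ‖ := by rw [hr, ← norm_pow, heq, norm_mul, hω, one_mul]
  have h3 : r ≤ p * r ^ 2 + (1 - p) := by
    calc r ≤ ‖(p : ℂ) * μ‖ + ‖(1 - p : ℂ)‖ := norm_add_le _ _
      _ = p * r ^ 2 + (1 - p) := by rw [norm_mul, hnp, hnq, hr2]
  have hr0 : 0 ≤ r := norm_nonneg _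
  rw [← hr2] at h2 ⊢
  -- If `r ≤ 1`, then `q ≤ p r² ≤ p`, against `p < q`.
  have h4 : 1 < r := by
    by_contra hle
    push Not at hle
    nlinarith
  have h5 : 1 - p ≤ p * r := by nlinarith
  nlinarith

/-- The root determines its index, since `ω^j = (pμ + q)² / μ`. -/
lemma mu_injective {p : ℝ} (hq : 0 < 1 - p) (ℓ : ℕ) (hℓ : 1 ≤ ℓ) :
    Function.Injective (fun j : Fin ℓ => (mu p ℓ j)⁻¹) := by
  intro i j hij
  have h : mu p ℓ i = mu p ℓ j := inv_injective hij
  have h1 := mu_equation p ℓ i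
  rw [h, mu_equation p ℓ j] at h1
  have h2 := mul_right_cancel₀ (mu_ne_zero hq ℓ j) h1
  exact Fin.ext ((isPrimitiveRoot_omega ℓ hℓ).pow_inj i.2 j.2 h2.symm)

lemma isUnit_det_VR {p : ℝ} (hq : 0 < 1 - p) (ℓ : ℕ) (hℓ : 1 ≤ ℓ) : IsUnit (VR p ℓ).det :=
  isUnit_iff_ne_zero.2 (Matrix.det_vandermonde_ne_zero_iff.2 (mu_injective hq ℓ hℓ))

/-- The left side is the reciprocal polynomial of `quad p ℓ j`, so its roots are the inverses of
`μ_j` and of `q² / (p² μ_j)`. -/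
lemma quadratic_factor {p : ℝ} (hq : 0 < 1 - p) (ℓ j : ℕ) :
    (C (1 - p : ℂ) * X + C (p : ℂ)) ^ 2 - C (omega ℓ ^ j) * X
      = C ((1 - p : ℂ) ^ 2) * (X - C (mu p ℓ j)⁻¹) *
        (X - C ((p : ℂ) ^ 2 * mu p ℓ j / (1 - p) ^ 2)) := by
  have hμ := mu_ne_zero hq ℓ j
  have hqc := one_sub_ofReal_ne_zero hq
  have h1 : omega ℓ ^ j = (p : ℂ) ^ 2 * mu p ℓ j + 2 * p * (1 - p)
      + (1 - p) ^ 2 * (mu p ℓ j)⁻¹ := by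
    have := mu_equation p ℓ j
    field_simp
    linear_combination -this
  set t := (mu p ℓ j)⁻¹
  have ht : mu p ℓ j * t = 1 := mul_inv_cancel₀ hμ
  set s := (p : ℂ) ^ 2 * mu p ℓ j / (1 - p) ^ 2 with hs
  have hs1 : (1 - p : ℂ) ^ 2 * s = (p : ℂ) ^ 2 * mu p ℓ j := by rw [hs]; field_simp
  have hs2 : (1 - p : ℂ) ^ 2 * (t * s) = (p : ℂ) ^ 2 := by linear_combination t * hs1 + p ^ 2 * ht
  have h2 : omega ℓ ^ j = (1 - p : ℂ) ^ 2 * s + 2 * p * (1 - p) + (1 - p) ^ 2 * t := by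
    rw [h1, hs1]
  have e : C ((1 - p : ℂ) ^ 2) * (X - C t) * (X - C s) = C ((1 - p : ℂ) ^ 2) * X ^ 2
      - C ((1 - p : ℂ) ^ 2 * s + (1 - p) ^ 2 * t) * X + C ((1 - p : ℂ) ^ 2 * (t * s)) := by
    simp only [map_mul, map_add]
    ring
  rw [e, hs2, h2]
  have e2 : C (2 : ℂ) = 2 := map_ofNat C 2
  simp only [map_mul, map_add, map_pow, e2]
  ring

lemma pow_sub_pow_eq_prod_fin {A : Type*} [CommRing A] [IsDomain A] {ζ : A} {n : ℕ}
    (hn : 0 < n) (h : IsPrimitiveRoot ζ n) (x y : A) :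
    x ^ n - y ^ n = ∏ j : Fin n, (x - ζ ^ (j : ℕ) * y) := by
  classical
  rw [h.pow_sub_pow_eq_prod_sub_mul x y hn]
  symm
  refine Finset.prod_bij (fun j _ => ζ ^ (j : ℕ)) ?_ ?_ ?_ ?_
  · intro j _
    rw [Polynomial.mem_nthRootsFinset hn, ← pow_mul, mul_comm, pow_mul, h.pow_eq_one, one_pow]
  · intro i _ j _ hij
    exact Fin.ext (h.pow_inj i.2 j.2 hij)
  · intro b hb
    have : NeZero n := ⟨hn.ne'⟩
    obtain ⟨i, hi, rfl⟩ := h.eq_pow_of_pow_eq_one ((Polynomial.mem_nthRootsFinset hn _).1 hb)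
    exact ⟨⟨i, hi⟩, Finset.mem_univ _, rfl⟩
  · intros; rfl

lemma map_revPoly (p : ℝ) (ℓ : ℕ) :
    (revPoly p ℓ).map Complex.ofRealHom = (C (1 - p : ℂ) * X + C (p : ℂ)) ^ (2 * ℓ) := by
  simp [revPoly]

lemma map_revPoly_sub_eq_prod {p : ℝ} (hq : 0 < 1 - p) (ℓ : ℕ) (hℓ : 1 ≤ ℓ) :
    (revPoly p ℓ).map Complex.ofRealHom - X ^ ℓ
      = C (((1 - p : ℂ) ^ 2) ^ ℓ) * (∏ j : Fin ℓ, (X - C (mu p ℓ j)⁻¹)) *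
        ∏ j : Fin ℓ, (X - C ((p : ℂ) ^ 2 * mu p ℓ j / (1 - p) ^ 2)) := by
  have hζ : IsPrimitiveRoot (C (omega ℓ)) ℓ :=
    (isPrimitiveRoot_omega ℓ hℓ).map_of_injective (C_injective (R := ℂ))
  rw [map_revPoly, pow_mul, pow_sub_pow_eq_prod_fin (by omega) hζ]
  simp_rw [← C_pow, quadratic_factor hq, Finset.prod_mul_distrib]
  simp

end Roots

/-! ### Linear recurrences as polynomials in the shift, and block sequences. -/

section Shift

open Polynomial

/-- The shift of complex sequences. -/
noncomputable def shift : Module.End ℂ (ℕ → ℂ) := LinearMap.funLeft ℂ ℂ Nat.succ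

lemma shift_pow_apply (k : ℕ) (u : ℕ → ℂ) (n : ℕ) : (shift ^ k) u n = u (n + k) := by
  induction k generalizing n with
  | zero => simp
  | succ k ih =>
    rw [pow_succ', Module.End.mul_apply]
    change (shift ^ k) u (n + 1) = _
    rw [ih]
    congr 1
    omega

lemma aeval_shift_apply (P : ℂ[X]) (u : ℕ → ℂ) (n N : ℕ) (hN : P.natDegree < N) :
    aeval shift P u n = ∑ k ∈ Finset.range N, P.coeff k * u (n + k) := by
  rw [aeval_eq_sum_range' hN, LinearMap.sum_apply, Finset.sum_apply]
  refine Finset.sum_congr rfl fun k _ => ?_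
  rw [LinearMap.smul_apply, Pi.smul_apply, shift_pow_apply, smul_eq_mul]

lemma aeval_shift_geometric (P : ℂ[X]) (t : ℂ) (h : P.IsRoot t) :
    aeval shift P (fun n => t ^ n) = 0 := by
  funext n
  rw [aeval_shift_apply P _ n _ (Nat.lt_succ_self _)]
  have := h.eq_zero
  rw [eval_eq_sum_range] at this
  simp_rw [pow_add, mul_left_comm _ (t ^ n), ← Finset.mul_sum]
  rw [this, mul_zero]
  rfl

/-- A solution of a monic linear recurrence with zero initial values vanishes. -/
lemma eq_zero_of_aeval_shift (P : ℂ[X]) (hP : P.Monic) (u : ℕ → ℂ)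
    (h : aeval shift P u = 0) (h0 : ∀ n < P.natDegree, u n = 0) : u = 0 := by
  funext n
  induction n using Nat.strong_induction_on with
  | _ n ih =>
    by_cases hn : n < P.natDegree
    · exact h0 n hn
    · push Not at hn
      have h1 := congrFun h (n - P.natDegree)
      rw [aeval_shift_apply P _ _ _ (Nat.lt_succ_self _), Finset.sum_range_succ,
        Finset.sum_eq_zero, zero_add, hP.coeff_natDegree, one_mul, Nat.sub_add_cancel hn] at h1
      · exact h1
      · intro k hk
        rw [Finset.mem_range] at hk
        rw [ih _ (by omega)]
        simp

variable {ℓ : ℕ}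

/-- The sequence whose consecutive blocks of length `ℓ` are `x`, `x R`, `x R²`, …. -/
noncomputable def blockSeq (hℓ : 0 < ℓ) (R : Matrix (Fin ℓ) (Fin ℓ) ℂ) :
    (Fin ℓ → ℂ) →ₗ[ℂ] (ℕ → ℂ) where
  toFun x n := Matrix.vecMul x (R ^ (n / ℓ)) ⟨n % ℓ, Nat.mod_lt n hℓ⟩
  map_add' x y := by funext n; simp [Matrix.add_vecMul]
  map_smul' a x := by funext n; simp [Matrix.smul_vecMul]

lemma blockSeq_apply (hℓ : 0 < ℓ) (R : Matrix (Fin ℓ) (Fin ℓ) ℂ) (x : Fin ℓ → ℂ) (n : ℕ)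
    (i : Fin ℓ) : blockSeq hℓ R x (ℓ * n + i) = Matrix.vecMul x (R ^ n) i := by
  have h1 : (ℓ * n + i) / ℓ = n := by
    rw [Nat.mul_add_div hℓ, Nat.div_eq_of_lt i.2, add_zero]
  have h2 : (⟨(ℓ * n + i) % ℓ, Nat.mod_lt _ hℓ⟩ : Fin ℓ) = i :=
    Fin.ext (by simp [Nat.mod_eq_of_lt i.2])
  change Matrix.vecMul x (R ^ ((ℓ * n + i) / ℓ)) ⟨(ℓ * n + i) % ℓ, _⟩ = _
  rw [h1, h2]

lemma exists_eq_block (hℓ : 0 < ℓ) (N : ℕ) : ∃ (n : ℕ) (i : Fin ℓ), N = ℓ * n + i :=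
  ⟨N / ℓ, ⟨N % ℓ, Nat.mod_lt N hℓ⟩, (Nat.div_add_mod N ℓ).symm⟩

lemma shift_pow_blockSeq (hℓ : 0 < ℓ) (R : Matrix (Fin ℓ) (Fin ℓ) ℂ) (x : Fin ℓ → ℂ) (k : ℕ) :
    ((shift ^ ℓ) ^ k) (blockSeq hℓ R x) = blockSeq hℓ R (Matrix.vecMul x (R ^ k)) := by
  funext N
  obtain ⟨n, i, rfl⟩ := exists_eq_block hℓ N
  have e : ℓ * n + i + ℓ * k = ℓ * (k + n) + i := by ring
  rw [← pow_mul, shift_pow_apply, blockSeq_apply, e, blockSeq_apply, Matrix.vecMul_vecMul, pow_add]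

lemma aeval_shift_pow_blockSeq (hℓ : 0 < ℓ) (R : Matrix (Fin ℓ) (Fin ℓ) ℂ) (x : Fin ℓ → ℂ)
    (P : ℂ[X]) :
    aeval (shift ^ ℓ) P (blockSeq hℓ R x) = blockSeq hℓ R (Matrix.vecMul x (aeval R P)) := by
  induction P using Polynomial.induction_on' with
  | add P Q hP hQ =>
    rw [map_add, map_add, LinearMap.add_apply, hP, hQ, Matrix.vecMul_add, map_add]
  | monomial k a =>
    rw [aeval_monomial, aeval_monomial, ← Algebra.smul_def, ← Algebra.smul_def,
      LinearMap.smul_apply, shift_pow_blockSeq, Matrix.vecMul_smul, map_smul]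

/-- Cayley–Hamilton: `shift ^ ℓ` acts on block sequences as right multiplication by `R`. -/
lemma aeval_shift_expand_charpoly_blockSeq (hℓ : 0 < ℓ) (R : Matrix (Fin ℓ) (Fin ℓ) ℂ)
    (x : Fin ℓ → ℂ) : aeval shift (expand ℂ ℓ R.charpoly) (blockSeq hℓ R x) = 0 := by
  rw [expand_aeval, aeval_shift_pow_blockSeq, Matrix.aeval_self_charpoly, Matrix.vecMul_zero,
    map_zero]

end Shift

/-! ### From the rate equation to the spectral decomposition. -/

section Recurrence

open Polynomial

variable {ℓ : ℕ} {p : ℝ}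

lemma vecMul_toComplex (x : Fin ℓ → ℂ) (A : Matrix (Fin ℓ) (Fin ℓ) ℝ) (j : Fin ℓ) :
    Matrix.vecMul x (toComplex A) j = ∑ i, A i j • x i := by
  simp [Matrix.vecMul, dotProduct, toComplex, mul_comm]

lemma toComplex_equation {R : Matrix (Fin ℓ) (Fin ℓ) ℝ}
    (h : R ^ 2 * blockDown p ℓ + R * (blockSame p ℓ - 1) + blockUp p ℓ = 0) :
    toComplex R ^ 2 * toComplex (blockDown p ℓ) + toComplex R * toComplex (blockSame p ℓ)
      + toComplex (blockUp p ℓ) = toComplex R := by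
  have h1 := congrArg (Complex.ofRealHom.mapMatrix) h
  simp only [map_add, map_mul, map_pow, map_sub, map_one, map_zero] at h1
  rw [mul_sub, mul_one] at h1
  rw [← sub_eq_zero, ← h1]
  change Complex.ofRealHom.mapMatrix R ^ 2 * Complex.ofRealHom.mapMatrix (blockDown p ℓ)
    + Complex.ofRealHom.mapMatrix R * Complex.ofRealHom.mapMatrix (blockSame p ℓ)
    + Complex.ofRealHom.mapMatrix (blockUp p ℓ) - Complex.ofRealHom.mapMatrix R = _
  abel

/-- At position `ℓ n + j` the recurrence is the `j`-th entry of `x Rⁿ` applied to the rate equation.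
-/
lemma aeval_shift_revPoly_blockSeq (hℓ : 0 < ℓ) {R : Matrix (Fin ℓ) (Fin ℓ) ℝ}
    (h : R ^ 2 * blockDown p ℓ + R * (blockSame p ℓ - 1) + blockUp p ℓ = 0) (x : Fin ℓ → ℂ) :
    aeval shift ((revPoly p ℓ).map Complex.ofRealHom - X ^ ℓ)
      (blockSeq hℓ (toComplex R) x) = 0 := by
  funext N
  obtain ⟨n, j, rfl⟩ := exists_eq_block hℓ N
  set u := blockSeq hℓ (toComplex R) x with hu
  have hdeg : ((revPoly p ℓ).map Complex.ofRealHom).natDegree < 2 * ℓ + 1 := by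
    rw [map_revPoly, Nat.lt_succ_iff]
    refine natDegree_pow_le_of_le (2 * ℓ) natDegree_linear_le |>.trans (by omega)
  rw [map_sub, LinearMap.sub_apply, Pi.sub_apply, aeval_shift_apply _ _ _ _ hdeg, map_pow, aeval_X,
    shift_pow_apply]
  have hb := block_sum p ℓ (fun s => u (ℓ * n + s)) j
  have e : ∀ r, ℓ * n + (j + r) = ℓ * n + j + r := fun r => by ring
  have e2 : ∀ i : Fin ℓ, u (ℓ * n + (2 * ℓ + i))
      = Matrix.vecMul (Matrix.vecMul x (toComplex R ^ n)) (toComplex R ^ 2) i := fun i => by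
    rw [show ℓ * n + (2 * ℓ + i) = ℓ * (n + 2) + i by ring, hu, blockSeq_apply,
      Matrix.vecMul_vecMul, pow_add]
  have e1 : ∀ i : Fin ℓ, u (ℓ * n + (ℓ + i))
      = Matrix.vecMul (Matrix.vecMul x (toComplex R ^ n)) (toComplex R) i := fun i => by
    rw [show ℓ * n + (ℓ + i) = ℓ * (n + 1) + i by ring, hu, blockSeq_apply,
      Matrix.vecMul_vecMul, pow_succ]
  have e0 : ∀ i : Fin ℓ, u (ℓ * n + i) = Matrix.vecMul x (toComplex R ^ n) i := fun i => by
    rw [hu, blockSeq_apply]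
  simp only [e2, e1, e0] at hb
  rw [← vecMul_toComplex, ← vecMul_toComplex, ← vecMul_toComplex,
    Matrix.vecMul_vecMul _ _ (toComplex (blockDown p ℓ)),
    Matrix.vecMul_vecMul _ _ (toComplex (blockSame p ℓ)), ← Pi.add_apply, ← Pi.add_apply,
    ← Matrix.vecMul_add,
    ← Matrix.vecMul_add, toComplex_equation h, ← e1] at hb
  simp only [e] at hb
  rw [show ℓ * n + (ℓ + j) = ℓ * n + j + ℓ by ring] at hb
  rw [hb, Pi.zero_apply, sub_eq_zero]
  refine Finset.sum_congr rfl fun r _ => ?_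
  rw [coeff_map, Complex.ofRealHom_eq_coe, Complex.real_smul]

/-- The geometric rows are left eigenvectors of every solution with spectrum in the unit disk. -/
lemma vecMul_geometric (hp : 0 < p) (hpq : p < 1 - p) (hℓ : 1 ≤ ℓ)
    {R : Matrix (Fin ℓ) (Fin ℓ) ℝ} (hR : IsRateMatrix p ℓ R) (j : Fin ℓ) :
    Matrix.vecMul (fun k : Fin ℓ => (mu p ℓ j)⁻¹ ^ (k : ℕ)) (toComplex R)
      = (mu p ℓ j)⁻¹ ^ ℓ • (fun k : Fin ℓ => (mu p ℓ j)⁻¹ ^ (k : ℕ)) := by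
  have hq : 0 < 1 - p := hp.trans hpq
  set x := fun k : Fin ℓ => (mu p ℓ j)⁻¹ ^ (k : ℕ) with hx
  set u := blockSeq hℓ (toComplex R) x with hu
  set g : ℂ[X] := ∏ j : Fin ℓ, (X - C (mu p ℓ j)⁻¹) with hg
  set s : Fin ℓ → ℂ := fun j => (p : ℂ) ^ 2 * mu p ℓ j / (1 - p) ^ 2 with hs
  set f : ℂ[X] := ∏ j : Fin ℓ, (X - C (s j)) with hf
  set a : ℂ[X] := expand ℂ ℓ (toComplex R).charpoly with ha
  -- The roots `s i` have modulus at least 1, while the roots of `a` have their `ℓ`-th power in the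
  -- open disk. As 1 is among the `s i`, strictness of the spectral condition is needed.
  have hcop : IsCoprime f a := by
    refine IsCoprime.prod_left fun i _ => ?_
    refine ((irreducible_X_sub_C (s i)).coprime_iff_not_dvd).2 fun hd => ?_
    rw [dvd_iff_isRoot, IsRoot.def, ha, expand_eval] at hd
    have h1 := hR.eigenvalue_lt_one (s i ^ ℓ) (Matrix.mem_spectrum_iff_isRoot_charpoly.2 hd)
    have h2 : 1 ≤ ‖s i‖ := by
      have hnq : ‖(1 - p : ℂ)‖ = 1 - p := by
        rw [← Complex.ofReal_one, ← Complex.ofReal_sub, Complex.norm_real,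
          Real.norm_of_nonneg hq.le]
      rw [hs]
      simp only
      rw [norm_div, norm_mul, norm_pow, norm_pow, Complex.norm_real, Real.norm_of_nonneg hp.le,
        hnq, one_le_div (by positivity)]
      exact sq_le_norm_mu hp hpq ℓ i hℓ
    rw [norm_pow] at h1
    exact absurd (one_le_pow₀ h2 (n := ℓ)) (not_le.2 h1)
  have hfg : aeval shift (f * g) u = 0 := by
    have h1 := aeval_shift_revPoly_blockSeq (hℓ := hℓ) hR.equation x
    rw [map_revPoly_sub_eq_prod hq ℓ hℓ, mul_assoc, map_mul, Module.End.mul_apply, aeval_C,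
      Module.algebraMap_end_apply] at h1
    have h2 : ((1 - p : ℂ) ^ 2) ^ ℓ ≠ 0 := pow_ne_zero _ (pow_ne_zero _ (one_sub_ofReal_ne_zero hq))
    rw [mul_comm f g]
    exact (smul_eq_zero.1 h1).resolve_left h2
  have hau : aeval shift a u = 0 := aeval_shift_expand_charpoly_blockSeq hℓ _ x
  have hgu : aeval shift g u = 0 := by
    obtain ⟨b, c, hbc⟩ := hcop
    -- Bézout times `g`: both terms on the right kill `u`.
    have h1 : g = b * (f * g) + c * g * a := by linear_combination -g * hbc
    rw [h1, map_add, LinearMap.add_apply, map_mul, Module.End.mul_apply, hfg, map_mul (aeval shift) (c * g),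
      Module.End.mul_apply, hau, map_zero, map_zero, add_zero]
  have hroot : g.IsRoot (mu p ℓ j)⁻¹ := by
    rw [← dvd_iff_isRoot]
    exact Finset.dvd_prod_of_mem (fun j : Fin ℓ => X - C (mu p ℓ j)⁻¹) (Finset.mem_univ j)
  have hdeg : g.natDegree = ℓ := by
    rw [hg, natDegree_finsetProd_X_sub_C_eq_card]
    simp
  -- Both sequences satisfy the recurrence of order `ℓ` given by `g`, and they agree on the first
  -- block.
  have hdiff : u - (fun n => (mu p ℓ j)⁻¹ ^ n) = 0 := by
    refine eq_zero_of_aeval_shift g (monic_prod_of_monic _ _ fun i _ => monic_X_sub_C _) _ ?_ ?_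
    · rw [map_sub, hgu, aeval_shift_geometric g _ hroot, sub_zero]
    · intro n hn
      rw [hdeg] at hn
      have := blockSeq_apply hℓ (toComplex R) x 0 ⟨n, hn⟩
      simp only [mul_zero, zero_add, pow_zero, Matrix.vecMul_one] at this
      rw [Pi.sub_apply, hu, this, hx]
      simp
  funext i
  have h1 := congrFun hdiff (ℓ * 1 + i)
  rw [Pi.sub_apply, hu, blockSeq_apply, pow_one, Pi.zero_apply, sub_eq_zero] at h1
  rw [h1, mul_one, pow_add, Pi.smul_apply, smul_eq_mul]

lemma VR_mul_toComplex (hp : 0 < p) (hpq : p < 1 - p) (hℓ : 1 ≤ ℓ)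
    {R : Matrix (Fin ℓ) (Fin ℓ) ℝ} (hR : IsRateMatrix p ℓ R) :
    VR p ℓ * toComplex R = DR p ℓ ^ ℓ * VR p ℓ := by
  ext i k
  have h := congrFun (vecMul_geometric hp hpq hℓ hR i) k
  rw [DR, Matrix.diagonal_pow, Matrix.diagonal_mul]
  exact h

lemma toComplex_eq (hp : 0 < p) (hpq : p < 1 - p) (hℓ : 1 ≤ ℓ)
    {R : Matrix (Fin ℓ) (Fin ℓ) ℝ} (hR : IsRateMatrix p ℓ R) :
    toComplex R = (VR p ℓ)⁻¹ * DR p ℓ ^ ℓ * VR p ℓ := by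
  rw [mul_assoc, ← VR_mul_toComplex hp hpq hℓ hR, ← mul_assoc,
    Matrix.nonsing_inv_mul _ (isUnit_det_VR (hp.trans hpq) ℓ hℓ), one_mul]

lemma toComplex_injective : Function.Injective (toComplex (ℓ := ℓ)) :=
  Matrix.map_injective Complex.ofReal_injective

end Recurrence

/-! ### Existence of the rate matrix by monotone iteration. -/

section Existence

open Polynomial

variable {ℓ : ℕ} {p : ℝ}

lemma levelBlock_one_nonneg (hp : 0 ≤ p) (hq : 0 ≤ 1 - p) (b : ℕ) (i j : Fin ℓ) :
    0 ≤ levelBlock p ℓ 1 b i j := by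
  rw [levelBlock, mul_one, cycleMatrix_add, coeff_X_pow_mul', coeff_linear_pow]
  split_ifs
  · positivity
  · exact le_rfl

lemma mul_apply_le_mul_apply {A A' B B' : Matrix (Fin ℓ) (Fin ℓ) ℝ} (hB : ∀ i j, 0 ≤ B i j)
    (hA' : ∀ i j, 0 ≤ A' i j) (hAA : ∀ i j, A i j ≤ A' i j) (hBB : ∀ i j, B i j ≤ B' i j)
    (i j : Fin ℓ) : (A * B) i j ≤ (A' * B') i j := by
  rw [Matrix.mul_apply, Matrix.mul_apply]
  exact Finset.sum_le_sum fun k _ => mul_le_mul (hAA i k) (hBB k j) (hB k j) (hA' i k)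

lemma mul_apply_nonneg {A B : Matrix (Fin ℓ) (Fin ℓ) ℝ} (hA : ∀ i j, 0 ≤ A i j)
    (hB : ∀ i j, 0 ≤ B i j) (i j : Fin ℓ) : 0 ≤ (A * B) i j := by
  rw [Matrix.mul_apply]
  exact Finset.sum_nonneg fun k _ => mul_nonneg (hA i k) (hB k j)

lemma vecMul_le_vecMul {x y : Fin ℓ → ℝ} {A : Matrix (Fin ℓ) (Fin ℓ) ℝ} (hA : ∀ i j, 0 ≤ A i j)
    (h : ∀ i, x i ≤ y i) (j : Fin ℓ) : Matrix.vecMul x A j ≤ Matrix.vecMul y A j := by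
  simp only [Matrix.vecMul, dotProduct]
  exact Finset.sum_le_sum fun i _ => mul_le_mul_of_nonneg_right (h i) (hA i j)

/-- The map whose fixed points are the solutions of the rate equation. -/
noncomputable def rateMap (p : ℝ) (ℓ : ℕ) (R : Matrix (Fin ℓ) (Fin ℓ) ℝ) :
    Matrix (Fin ℓ) (Fin ℓ) ℝ :=
  R * R * blockDown p ℓ + R * blockSame p ℓ + blockUp p ℓ

lemma rateMap_nonneg (hp : 0 ≤ p) (hq : 0 ≤ 1 - p) {R : Matrix (Fin ℓ) (Fin ℓ) ℝ}
    (hR : ∀ i j, 0 ≤ R i j) (i j : Fin ℓ) : 0 ≤ rateMap p ℓ R i j :=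
  add_nonneg (add_nonneg
    (mul_apply_nonneg (mul_apply_nonneg hR hR) (levelBlock_one_nonneg hp hq 0) i j)
    (mul_apply_nonneg hR (levelBlock_one_nonneg hp hq 1) i j))
    (levelBlock_one_nonneg hp hq 2 i j)

lemma rateMap_mono (hp : 0 ≤ p) (hq : 0 ≤ 1 - p) {R S : Matrix (Fin ℓ) (Fin ℓ) ℝ}
    (hR : ∀ i j, 0 ≤ R i j) (hRS : ∀ i j, R i j ≤ S i j) (i j : Fin ℓ) :
    rateMap p ℓ R i j ≤ rateMap p ℓ S i j := by
  have hS : ∀ i j, 0 ≤ S i j := fun i j => (hR i j).trans (hRS i j)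
  have hD : ∀ i j, 0 ≤ blockDown p ℓ i j := levelBlock_one_nonneg hp hq 0
  have hM : ∀ i j, 0 ≤ blockSame p ℓ i j := levelBlock_one_nonneg hp hq 1
  exact add_le_add (add_le_add
    (mul_apply_le_mul_apply hD (mul_apply_nonneg hS hS) (mul_apply_le_mul_apply hR hS hRS hRS)
      (fun _ _ => le_rfl) i j)
    (mul_apply_le_mul_apply hM hS hRS (fun _ _ => le_rfl) i j)) le_rfl

/-- By `ht`, `t` is a root of the characteristic polynomial `(qX + p)^(2ℓ) - X^ℓ`. -/
lemma blocks_geometric {t : ℝ} (ht : ((1 - p) * t + p) ^ 2 = t) (j : Fin ℓ) :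
    t ^ ℓ * t ^ ℓ * Matrix.vecMul (fun i : Fin ℓ => t ^ (i : ℕ)) (blockDown p ℓ) j
      + t ^ ℓ * Matrix.vecMul (fun i : Fin ℓ => t ^ (i : ℕ)) (blockSame p ℓ) j
      + Matrix.vecMul (fun i : Fin ℓ => t ^ (i : ℕ)) (blockUp p ℓ) j = t ^ ℓ * t ^ (j : ℕ) := by
  have h := block_sum p ℓ (fun s => t ^ s) j
  have h2 : ∑ r ∈ Finset.range (2 * ℓ + 1), (revPoly p ℓ).coeff r • t ^ (j + r)
      = t ^ ℓ * t ^ (j : ℕ) := by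
    have hdeg : (revPoly p ℓ).natDegree < 2 * ℓ + 1 := by
      rw [revPoly, Nat.lt_succ_iff]
      exact natDegree_pow_le_of_le (2 * ℓ) natDegree_linear_le |>.trans (by omega)
    have he : (revPoly p ℓ).eval t = t ^ ℓ := by
      rw [revPoly, pow_mul]
      simp [ht]
    rw [← he, eval_eq_sum_range' hdeg, Finset.sum_mul]
    refine Finset.sum_congr rfl fun r _ => ?_
    rw [smul_eq_mul, pow_add]
    ring
  rw [← h2, ← h]
  simp only [Matrix.vecMul, dotProduct, Finset.mul_sum, smul_eq_mul]
  congr 1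
  congr 1
  all_goals
    refine Finset.sum_congr rfl fun i _ => ?_
    ring

/-- Subinvariance of the geometric row survives the iteration. It both bounds the iterates and, in
the limit, controls the spectrum. -/
lemma vecMul_rateMap_le (hp : 0 ≤ p) (hq : 0 ≤ 1 - p) {t : ℝ} (ht0 : 0 ≤ t)
    (ht : ((1 - p) * t + p) ^ 2 = t) {R : Matrix (Fin ℓ) (Fin ℓ) ℝ} (hR : ∀ i j, 0 ≤ R i j)
    (h : ∀ j, Matrix.vecMul (fun i : Fin ℓ => t ^ (i : ℕ)) R j ≤ t ^ ℓ * t ^ (j : ℕ))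
    (j : Fin ℓ) :
    Matrix.vecMul (fun i : Fin ℓ => t ^ (i : ℕ)) (rateMap p ℓ R) j ≤ t ^ ℓ * t ^ (j : ℕ) := by
  set x : Fin ℓ → ℝ := fun i => t ^ (i : ℕ) with hx
  have hD : ∀ i j, 0 ≤ blockDown p ℓ i j := levelBlock_one_nonneg hp hq 0
  have hM : ∀ i j, 0 ≤ blockSame p ℓ i j := levelBlock_one_nonneg hp hq 1
  have h' : ∀ j, Matrix.vecMul x R j ≤ (t ^ ℓ • x) j := h
  have h2 : ∀ j, Matrix.vecMul x (R * R) j ≤ ((t ^ ℓ * t ^ ℓ) • x) j := fun j => by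
    rw [← Matrix.vecMul_vecMul]
    refine (vecMul_le_vecMul hR h' j).trans ?_
    rw [Matrix.smul_vecMul, mul_smul, Pi.smul_apply, Pi.smul_apply (t ^ ℓ) (t ^ ℓ • x)]
    exact smul_le_smul_of_nonneg_left (h' j) (pow_nonneg ht0 _)
  rw [rateMap, Matrix.vecMul_add, Matrix.vecMul_add, ← Matrix.vecMul_vecMul x (R * R),
    ← Matrix.vecMul_vecMul x R (blockSame p ℓ), ← blocks_geometric ht j]
  refine add_le_add (add_le_add ?_ ?_) le_rfl
  · refine (vecMul_le_vecMul hD h2 j).trans_eq ?_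
    rw [Matrix.smul_vecMul]
    rfl
  · refine (vecMul_le_vecMul hM h' j).trans_eq ?_
    rw [Matrix.smul_vecMul]
    rfl

/-- A non-negative matrix with a positive subinvariant row has its spectrum in a disk. -/
lemma norm_le_of_mem_spectrum {R : Matrix (Fin ℓ) (Fin ℓ) ℝ} (hR : ∀ i j, 0 ≤ R i j)
    {x : Fin ℓ → ℝ} (hx : ∀ i, 0 < x i) {c : ℝ} (h : ∀ j, Matrix.vecMul x R j ≤ c * x j)
    {z : ℂ} (hz : z ∈ spectrum ℂ (toComplex R)) : ‖z‖ ≤ c := by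
  rw [← Matrix.spectrum_toLin', ← Module.End.hasEigenvalue_iff_mem_spectrum] at hz
  obtain ⟨y, hy⟩ := hz.exists_hasEigenvector
  have hy0 := hy.2
  have hyz : ∀ i, ∑ j, (R i j : ℂ) * y j = z * y i := fun i => congrFun hy.apply_eq_smul i
  have hpos : 0 < ∑ i, x i * ‖y i‖ := by
    obtain ⟨i, hi⟩ := Function.ne_iff.1 hy0
    exact Finset.sum_pos' (fun i _ => mul_nonneg (hx i).le (norm_nonneg _))
      ⟨i, Finset.mem_univ i, mul_pos (hx i) (norm_pos_iff.2 hi)⟩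
  refine le_of_mul_le_mul_right ?_ hpos
  -- Pair the positive row `x` with the moduli of a right eigenvector `y`.
  calc ‖z‖ * ∑ i, x i * ‖y i‖ = ∑ i, x i * ‖∑ j, (R i j : ℂ) * y j‖ := by
        rw [Finset.mul_sum]
        refine Finset.sum_congr rfl fun i _ => ?_
        rw [hyz, norm_mul]
        ring
    _ ≤ ∑ i, x i * ∑ j, R i j * ‖y j‖ := by
        refine Finset.sum_le_sum fun i _ => mul_le_mul_of_nonneg_left ?_ (hx i).le
        refine (norm_sum_le _ _).trans_eq (Finset.sum_congr rfl fun j _ => ?_)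
        rw [norm_mul, Complex.norm_real, Real.norm_of_nonneg (hR i j)]
    _ = ∑ j, Matrix.vecMul x R j * ‖y j‖ := by
        simp only [Matrix.vecMul, dotProduct, Finset.mul_sum, Finset.sum_mul]
        rw [Finset.sum_comm]
        exact Finset.sum_congr rfl fun j _ => Finset.sum_congr rfl fun i _ => by ring
    _ ≤ ∑ j, c * x j * ‖y j‖ :=
        Finset.sum_le_sum fun j _ => mul_le_mul_of_nonneg_right (h j) (norm_nonneg _)
    _ = c * ∑ i, x i * ‖y i‖ := by
        rw [Finset.mul_sum]
        exact Finset.sum_congr rfl fun i _ => by ring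

open Filter Topology in
lemma exists_isRateMatrix (hp : 0 < p) (hpq : p < 1 - p) (hℓ : 1 ≤ ℓ) :
    ∃ R : Matrix (Fin ℓ) (Fin ℓ) ℝ, IsRateMatrix p ℓ R := by
  have hq : 0 < 1 - p := hp.trans hpq
  obtain ⟨t, ht0, ht1, ht⟩ : ∃ t : ℝ, 0 < t ∧ t < 1 ∧ ((1 - p) * t + p) ^ 2 = t := by
    -- The root of `(qt + p)² = t` other than 1; it is below 1 because `p < q`.
    refine ⟨(p / (1 - p)) ^ 2, by positivity, ?_, ?_⟩
    · exact pow_lt_one₀ (by positivity) ((div_lt_one hq).2 hpq) two_ne_zero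
    · field_simp
      ring
  set x : Fin ℓ → ℝ := fun i => t ^ (i : ℕ) with hx
  have hx0 : ∀ i, 0 < x i := fun i => pow_pos ht0 _
  set S : ℕ → Matrix (Fin ℓ) (Fin ℓ) ℝ := fun k => (rateMap p ℓ)^[k] 0 with hS
  have hsucc : ∀ k, S (k + 1) = rateMap p ℓ (S k) := fun k => Function.iterate_succ_apply' _ _ _
  have hnonneg : ∀ k i j, 0 ≤ S k i j := by
    intro k
    induction k with
    | zero => exact fun i j => le_rfl
    | succ k ih => rw [hsucc]; exact rateMap_nonneg hp.le hq.le ih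
  have hstep : ∀ k i j, S k i j ≤ S (k + 1) i j := by
    intro k
    induction k with
    | zero => exact fun i j => hnonneg 1 i j
    | succ k ih => rw [hsucc k, hsucc (k + 1)]; exact rateMap_mono hp.le hq.le (hnonneg k) ih
  have hsub : ∀ k j, Matrix.vecMul x (S k) j ≤ t ^ ℓ * x j := by
    intro k
    induction k with
    | zero =>
      intro j
      change Matrix.vecMul x 0 j ≤ _
      rw [Matrix.vecMul_zero]
      exact mul_nonneg (pow_nonneg ht0.le _) (hx0 j).le
    | succ k ih => rw [hsucc]; exact vecMul_rateMap_le hp.le hq.le ht0.le ht (hnonneg k) ih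
  have hbdd : ∀ i j, BddAbove (Set.range fun k => S k i j) := by
    intro i j
    refine ⟨t ^ ℓ * x j / x i, ?_⟩
    rintro _ ⟨k, rfl⟩
    rw [le_div_iff₀ (hx0 i), mul_comm]
    -- One term `x i * S k i j` is at most the whole `j`-th entry of `x S_k`.
    exact (Finset.single_le_sum (f := fun i => x i * S k i j)
      (fun i _ => mul_nonneg (hx0 i).le (hnonneg k i j)) (Finset.mem_univ i)).trans (hsub k j)
  set R : Matrix (Fin ℓ) (Fin ℓ) ℝ := fun i j => ⨆ k, S k i j with hR
  have hlim : Tendsto S atTop (𝓝 R) :=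
    tendsto_pi_nhds.2 fun i => tendsto_pi_nhds.2 fun j =>
      tendsto_atTop_ciSup (monotone_nat_of_le_succ fun k => hstep k i j) (hbdd i j)
  have hcont : Continuous (rateMap p ℓ) := by
    unfold rateMap
    fun_prop
  have hfix : rateMap p ℓ R = R := by
    refine tendsto_nhds_unique ((hcont.tendsto R).comp hlim) ?_
    exact ((tendsto_add_atTop_iff_nat 1).2 hlim).congr hsucc
  have hR0 : ∀ i j, 0 ≤ R i j := fun i j => Real.iSup_nonneg fun k => hnonneg k i j
  have hRsub : ∀ j, Matrix.vecMul x R j ≤ t ^ ℓ * x j := by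
    intro j
    have hc : Continuous fun A : Matrix (Fin ℓ) (Fin ℓ) ℝ => Matrix.vecMul x A j := by
      unfold Matrix.vecMul dotProduct
      fun_prop
    exact le_of_tendsto ((hc.tendsto R).comp hlim) (Eventually.of_forall fun k => hsub k j)
  refine ⟨R, hR0, fun z hz => ?_, ?_⟩
  · exact (norm_le_of_mem_spectrum hR0 hx0 hRsub hz).trans_lt
      (pow_lt_one₀ ht0.le ht1 (by omega))
  · calc R ^ 2 * blockDown p ℓ + R * (blockSame p ℓ - 1) + blockUp p ℓ
        = rateMap p ℓ R - R := by rw [rateMap, pow_two, mul_sub, mul_one]; abel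
      _ = 0 := by rw [hfix, sub_self]

end Existence

/-! ### Left eigenvectors in the basis of geometric rows. -/

section LeftEigenvectors

variable {ℓ : ℕ} {p : ℝ}

lemma vecMul_VR (y : Fin ℓ → ℂ) :
    Matrix.vecMul y (VR p ℓ) = ∑ j, y j • (fun k : Fin ℓ => (mu p ℓ j)⁻¹ ^ (k : ℕ)) := by
  funext k
  simp [Matrix.vecMul, dotProduct, VR, Matrix.vandermonde_apply]

/-- A left eigenvector is a combination of the geometric rows with the same eigenvalue. -/
lemma exists_coeff_of_isLeftEigenvector (hp : 0 < p) (hpq : p < 1 - p) (hℓ : 1 ≤ ℓ)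
    {R : Matrix (Fin ℓ) (Fin ℓ) ℝ} (hR : IsRateMatrix p ℓ R) {c : ℂ} {x : Fin ℓ → ℂ}
    (h : IsLeftEigenvector (toComplex R) c x) :
    ∃ y : Fin ℓ → ℂ, x = ∑ j, y j • (fun k : Fin ℓ => (mu p ℓ j)⁻¹ ^ (k : ℕ)) ∧
      (∃ j, y j ≠ 0) ∧ ∀ j, y j ≠ 0 → c = (mu p ℓ j)⁻¹ ^ ℓ := by
  have hV := isUnit_det_VR (hp.trans hpq) ℓ hℓ
  -- Coordinates of `x` in the basis of geometric rows, in which `R` acts diagonally.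
  set y := Matrix.vecMul x (VR p ℓ)⁻¹ with hy
  have hxy : x = Matrix.vecMul y (VR p ℓ) := by
    rw [hy, Matrix.vecMul_vecMul, Matrix.nonsing_inv_mul _ hV, Matrix.vecMul_one]
  have hyD : Matrix.vecMul y (DR p ℓ ^ ℓ) = c • y := by
    have h1 := h.2
    rw [toComplex_eq hp hpq hℓ hR, ← Matrix.vecMul_vecMul, ← Matrix.vecMul_vecMul, ← hy] at h1
    have h2 := congrArg (fun v => Matrix.vecMul v (VR p ℓ)⁻¹) h1
    rwa [Matrix.vecMul_vecMul, Matrix.mul_nonsing_inv _ hV, Matrix.vecMul_one,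
      Matrix.smul_vecMul] at h2
  refine ⟨y, by rw [hxy, vecMul_VR], ?_, fun j hj => ?_⟩
  · by_contra! hall
    apply h.1
    rw [hxy, show y = 0 from funext hall, Matrix.zero_vecMul]
  · have h1 := congrFun hyD j
    rw [DR, Matrix.diagonal_pow, Matrix.vecMul_diagonal, Pi.smul_apply, smul_eq_mul,
      mul_comm c] at h1
    exact (mul_left_cancel₀ hj h1).symm

end LeftEigenvectors

end TrafficLight

open TrafficLight in
theorem theorem1 (p : ℝ) (hp : 0 < p) (hpq : p < 1 - p) (ℓ : ℕ) (hℓ : 1 ≤ ℓ) :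
    (∃! R : Matrix (Fin ℓ) (Fin ℓ) ℝ, IsRateMatrix p ℓ R) ∧
    ∀ R : Matrix (Fin ℓ) (Fin ℓ) ℝ, IsRateMatrix p ℓ R →
      -- the spectral decomposition
      IsUnit (VR p ℓ).det ∧
      toComplex R = (VR p ℓ)⁻¹ * DR p ℓ ^ ℓ * VR p ℓ ∧
      -- each row of the Vandermonde matrix is a left eigenvector
      (∀ j : Fin ℓ,
        IsLeftEigenvector (toComplex R) ((mu p ℓ j)⁻¹ ^ ℓ) (fun k : Fin ℓ => (mu p ℓ j)⁻¹ ^ (k : ℕ))) ∧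
      -- every left eigenvector comes from these rows
      (∀ (c : ℂ) (x : Fin ℓ → ℂ), IsLeftEigenvector (toComplex R) c x →
        (∃ j : Fin ℓ, c = (mu p ℓ j)⁻¹ ^ ℓ) ∧
        x ∈ Submodule.span ℂ
          {v | ∃ j : Fin ℓ, c = (mu p ℓ j)⁻¹ ^ ℓ ∧ v = fun k : Fin ℓ => (mu p ℓ j)⁻¹ ^ (k : ℕ)}) ∧
      -- and is, up to a scalar, one of these rows when its eigenvalue is simple
      (∀ (c : ℂ) (x : Fin ℓ → ℂ), IsLeftEigenvector (toComplex R) c x →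
        (∀ i j : Fin ℓ, c = (mu p ℓ i)⁻¹ ^ ℓ → c = (mu p ℓ j)⁻¹ ^ ℓ → i = j) →
        ∃ (j : Fin ℓ) (a : ℂ), a ≠ 0 ∧ c = (mu p ℓ j)⁻¹ ^ ℓ ∧
          x = a • (fun k : Fin ℓ => (mu p ℓ j)⁻¹ ^ (k : ℕ))) := by
  have hq : 0 < 1 - p := hp.trans hpq
  refine ⟨?_, fun R hR => ⟨isUnit_det_VR hq ℓ hℓ, toComplex_eq hp hpq hℓ hR, fun j => ⟨?_, ?_⟩, ?_, ?_⟩⟩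
  · obtain ⟨R, hR⟩ := exists_isRateMatrix hp hpq hℓ
    refine ⟨R, hR, fun S hS => toComplex_injective ?_⟩
    -- Uniqueness: the spectral formula involves only `p` and `ℓ`.
    rw [toComplex_eq hp hpq hℓ hR, toComplex_eq hp hpq hℓ hS]
  · intro h
    -- The entry of index 0 is 1.
    simpa using congrFun h ⟨0, hℓ⟩
  · exact vecMul_geometric hp hpq hℓ hR j
  · intro c x hx
    obtain ⟨y, rfl, ⟨j, hj⟩, hy⟩ := exists_coeff_of_isLeftEigenvector hp hpq hℓ hR hx
    refine ⟨⟨j, hy j hj⟩, Submodule.sum_mem _ fun i _ => ?_⟩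
    by_cases hi : y i = 0
    · rw [hi, zero_smul]
      exact Submodule.zero_mem _
    · exact Submodule.smul_mem _ _ (Submodule.subset_span ⟨i, hy i hi, rfl⟩)
  · intro c x hx huniq
    obtain ⟨y, rfl, ⟨j, hj⟩, hy⟩ := exists_coeff_of_isLeftEigenvector hp hpq hℓ hR hx
    refine ⟨j, y j, hj, hy j hj, Finset.sum_eq_single j (fun i _ hij => ?_) (by simp)⟩
    have hi : y i = 0 := by
      by_contra hi
      exact hij (huniq i j (hy i hi) (hy j hj))
    rw [hi, zero_smul]
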